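/- Let $\mathbb K\in\{\mathbb R,\mathbb C\}$, let $1<p<\infty$ and $1/p+1/p'=1$, and let $\ell_p=\ell_p(\mathbb N)$ be the space of $p$-summable scalar sequences. Let $Y$ be a Banach space over $\mathbb K$ with norm dual $Y^*$, and suppose that there is a sequence of compact linear operators $K_n:Y\to Y$ such that (a) $K_ny\to y$ in norm for all $y\in Y$, (b) $K_n^*y^*\to y^*$ in norm for all $y^*\in Y^*$, where $K_n^*y^*=y^*\circ K_n$, (c) $\|\mathrm{Id}_Y-2K_n\|\to 1$. Suppose moreover that $$\limsup_n\bigl(\|y^*\|^{p'}+\|y_n^*\|^{p'}\bigr)^{1/p'}\le\limsup_n\left(\frac{\|y^*+y_n^*\|^{p'}+\|y^*-y_n^*\|^{p'}}{2}\right)^{1/p'}$$ for all $y^*\in Y^*$ and all sequences $(y_n^*)$ in $Y^*$ with $y_n^*\to 0$ in the weak$^*$ topology. Then the space $K(\ell_p,Y)$ of compact operators is an $M$-ideal in the space $L(\ell_p,Y)$ of bounded linear operators with the operator norm. Here a closed subspace $J$ of a Banach space $X$ is called an $M$-ideal in $X$ if there is a closed subspace $V$ of $X^*$ such that $X^*=J^\perp\oplus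 V$ and $\|f+g\|=\|f\|+\|g\|$ for all $f\in J^\perp$ and $g\in V$, where $J^\perp=\{f\in X^*: f|_J=0\}$. -/

import Mathlib

open Filter Topology

/-- The annihilator `J^⊥ = {f ∈ X^* : f|_J = 0}` of a subspace `J` in the normed dual of `X`. -/
def normedAnnihilator {𝕜 X : Type*} [RCLike 𝕜] [NormedAddCommGroup X] [NormedSpace 𝕜 X]
    (J : Submodule 𝕜 X) : Submodule 𝕜 (StrongDual 𝕜 X) where
  carrier := {f | ∀ x ∈ J, f x = 0}
  add_mem' := by
    intro f g hf hg x hx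
    simp [hf x hx, hg x hx]
  zero_mem' := by
    intro x _
    simp
  smul_mem' := by
    intro c f hf x hx
    simp [hf x hx]

/-- `J` is an `M`-ideal in `X`: `J` is closed and the normed dual of `X` is the `ℓ₁`-direct sum of
the annihilator of `J` and some closed subspace `V`. -/
def IsMIdeal {𝕜 X : Type*} [RCLike 𝕜] [NormedAddCommGroup X] [NormedSpace 𝕜 X]
    (J : Submodule 𝕜 X) : Prop :=
  IsClosed (J : Set X) ∧
    ∃ V : Submodule 𝕜 (StrongDual 𝕜 X),
      IsClosed (V : Set (StrongDual 𝕜 X)) ∧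
      IsCompl (normedAnnihilator J) V ∧
      ∀ f ∈ normedAnnihilator J, ∀ g ∈ V, ‖f + g‖ = ‖f‖ + ‖g‖

/-! Everything reduces to one estimate: for contractions `T`, `S` into `Y`, `K n T + (Id - K m) S`
has norm at most `1 + ε` once `n` is large and then `m` is large depending on `n`. If it fails, take
functionals almost norming these operators, with `n` fixed, and pass to a weak* convergent
subsequence `g + z k` with `z k` weak* null. Up to norm-null terms, the composition is `g K n T + z
k (Id - K m) S`. The second summand is pointwise null on `ℓ_p`, so the two norms combine at most
like an `ℓ_q`-sum, `q = p'` (`eventually_norm_add_le`). On `Y^*`, `‖Id - 2 K n‖ → 1` makes `g - z k`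
asymptotically contractive like `g + z k`, and the averaging hypothesis bounds the `ℓ_q`-sum of
`‖g‖` and `‖z k‖` by nearly `1` (`eventually_rpow_add_rpow_le`). Given the estimate, the limit of `f
(K n T)` along an ultrafilter defines a projection on the dual with kernel `J^⊥`, and its range is
the required complement. -/

/-! ### Norming vectors, compactness and duality of `ℓ_p`-decompositions -/

section Operators

variable {𝕜 : Type*} [RCLike 𝕜]
  {E F G : Type*} [NormedAddCommGroup E] [NormedSpace 𝕜 E]
  [NormedAddCommGroup F] [NormedSpace 𝕜 F] [NormedAddCommGroup G] [NormedSpace 𝕜 G]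

/-- A functional almost attains its norm at a vector of the unit ball at which its value is a
nonnegative real number. -/
theorem exists_norm_le_one_apply_eq_norm (f : StrongDual 𝕜 E) {r : ℝ} (hr : r < ‖f‖) :
    ∃ x : E, ‖x‖ ≤ 1 ∧ f x = (‖f x‖ : 𝕜) ∧ r < ‖f x‖ := by
  obtain ⟨x, hx, hrx⟩ := f.exists_lt_apply_of_lt_opNorm hr
  obtain ⟨c, hc, hcx⟩ := RCLike.exists_norm_eq_mul_self (f x)
  refine ⟨c • x, ?_, ?_, ?_⟩
  · rw [norm_smul, hc, one_mul]; exact hx.le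
  · rw [map_smul, smul_eq_mul, ← hcx, norm_algebraMap', norm_norm]
  · rw [map_smul, norm_smul, hc, one_mul]; exact hrx

/-- An eventually bounded family of operators that tends to zero pointwise tends to zero in norm
after composition with a compact operator. -/
theorem IsCompactOperator.tendsto_comp_zero {ι : Type*} {l : Filter ι} {C : E →L[𝕜] F}
    (hC : IsCompactOperator C) {A : ι → F →L[𝕜] G} {M : ℝ}
    (hM : ∀ᶠ i in l, ‖A i‖ ≤ M) (hA : ∀ y, Tendsto (fun i => A i y) l (𝓝 0)) :
    Tendsto (fun i => (A i).comp C) l (𝓝 0) := by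
  rw [Metric.tendsto_nhds]
  intro ε hε
  set M' := max M 0 + 1 with hM'
  have hM'pos : 0 < M' := by positivity
  have hK := hC.isCompact_closure_image_closedBall (f := (C : E →ₗ[𝕜] F)) 1
  obtain ⟨t, ht, hcov⟩ := Metric.totallyBounded_iff.1 hK.totallyBounded (ε / 4 / M')
    (by positivity)
  have hfin : ∀ᶠ i in l, ∀ y ∈ t, ‖A i y‖ < ε / 4 := by
    rw [eventually_all_finite ht]
    intro y _
    have := (hA y).norm
    rw [norm_zero] at this
    exact this.eventually (gt_mem_nhds (by positivity))
  filter_upwards [hfin, hM] with i hi hMi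
  rw [dist_zero_right]
  refine lt_of_le_of_lt (ContinuousLinearMap.opNorm_le_of_unit_norm (𝕜 := 𝕜) (C := ε / 2)
    (by positivity) ?_) (by linarith)
  intro x hx
  have hx' : C x ∈ closure ((C : E →ₗ[𝕜] F) '' Metric.closedBall 0 1) :=
    subset_closure ⟨x, by simp [hx], rfl⟩
  obtain ⟨y, hy, hxy⟩ := Set.mem_iUnion₂.1 (hcov hx')
  rw [Metric.mem_ball, dist_eq_norm] at hxy
  have h1 : ‖A i (C x - y)‖ ≤ ε / 4 := by
    calc ‖A i (C x - y)‖ ≤ ‖A i‖ * ‖C x - y‖ := (A i).le_opNorm _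
      _ ≤ M' * (ε / 4 / M') := by
        gcongr
        linarith [le_max_left M 0]
      _ = ε / 4 := by field_simp
  have h2 : (A i).comp C x = A i (C x - y) + A i y := by simp
  rw [h2]
  linarith [norm_add_le (A i (C x - y)) (A i y), hi y hy]

theorem IsCompactOperator.isSeparable_range {C : E →L[𝕜] F} (hC : IsCompactOperator C) :
    TopologicalSpace.IsSeparable (Set.range C) := by
  have h : Set.range C ⊆ ⋃ n : ℕ, closure ((C : E →ₗ[𝕜] F) '' Metric.closedBall 0 (n : ℝ)) := by
    rintro _ ⟨x, rfl⟩
    obtain ⟨n, hn⟩ := exists_nat_ge ‖x‖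
    exact Set.mem_iUnion.2 ⟨n, subset_closure ⟨x, by simpa using hn, rfl⟩⟩
  exact (TopologicalSpace.IsSeparable.iUnion fun n : ℕ =>
    (hC.isCompact_closure_image_closedBall (f := (C : E →ₗ[𝕜] F)) n).isSeparable).mono h

/-- Separability makes bounded sets of functionals weak* sequentially compact, so sequences rather
than nets suffice. -/
theorem separableSpace_of_tendsto_isCompactOperator {K : ℕ → E →L[𝕜] E}
    (hK : ∀ n, IsCompactOperator (K n)) (h : ∀ y, Tendsto (fun n => K n y) atTop (𝓝 y)) :
    TopologicalSpace.SeparableSpace E := by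
  rw [← TopologicalSpace.isSeparable_univ_iff]
  refine ((TopologicalSpace.IsSeparable.iUnion fun n : ℕ =>
    (hK n).isSeparable_range).closure).mono fun y _ => ?_
  exact mem_closure_of_tendsto (h y)
    (Eventually.of_forall fun n => Set.mem_iUnion.2 ⟨n, y, rfl⟩)

theorem exists_seq_tendsto_weakDual [TopologicalSpace.SeparableSpace E]
    (f : ℕ → StrongDual 𝕜 E) {r : ℝ} (hf : ∀ n, ‖f n‖ ≤ r) :
    ∃ (g : StrongDual 𝕜 E) (φ : ℕ → ℕ), StrictMono φ ∧
      ∀ x, Tendsto (fun n => f (φ n) x) atTop (𝓝 (g x)) := by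
  obtain ⟨g, -, φ, hφ, h⟩ := WeakDual.isSeqCompact_closedBall 𝕜 E 0 r
    (x := fun n => StrongDual.toWeakDual (f n)) (fun n => by simpa using hf n)
  refine ⟨WeakDual.toStrongDual g, φ, hφ, fun x => ?_⟩
  exact ((WeakDual.eval_continuous x).tendsto g).comp h

/-- Two functionals applied to complementary parts: the dual of an `ℓ_p`-sum is the `ℓ_q`-sum of
the duals. -/
theorem norm_comp_rpow_add_norm_comp_rpow_le {p q : ℝ} (hpq : p.HolderConjugate q)
    {P : E →L[𝕜] E} (hP : ∀ x, ‖P x‖ ^ p + ‖x - P x‖ ^ p = ‖x‖ ^ p) (hPP : ∀ x, P (P x) = P x)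
    (φ : StrongDual 𝕜 E) :
    ‖φ.comp P‖ ^ q + ‖φ.comp (ContinuousLinearMap.id 𝕜 E - P)‖ ^ q ≤ ‖φ‖ ^ q := by
  set Q := ContinuousLinearMap.id 𝕜 E - P with hQ
  set α := ‖φ.comp P‖ with hα
  set β := ‖φ.comp Q‖ with hβ
  have hp0 := hpq.pos
  have hq0 := hpq.symm.pos
  have key : ∀ a b : ℝ, 0 ≤ a → 0 ≤ b → a * α + b * β ≤ ‖φ‖ * (a ^ p + b ^ p) ^ (1 / p) := by
    intro a b ha hb
    refine le_of_forall_pos_le_add fun ε hε => ?_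
    set δ := ε / (a + b + 1) with hδ
    have hδ0 : 0 < δ := by positivity
    obtain ⟨u, hu, hu1, hu2⟩ := exists_norm_le_one_apply_eq_norm (φ.comp P)
      (show α - δ < ‖φ.comp P‖ by rw [← hα]; linarith)
    obtain ⟨v, hv, hv1, hv2⟩ := exists_norm_le_one_apply_eq_norm (φ.comp Q)
      (show β - δ < ‖φ.comp Q‖ by rw [← hβ]; linarith)
    have hPu : ‖P u‖ ≤ 1 := by
      refine le_trans ?_ hu
      rw [← Real.rpow_le_rpow_iff (norm_nonneg _) (norm_nonneg _) hp0, ← hP u]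
      linarith [Real.rpow_nonneg (norm_nonneg (u - P u)) p]
    have hQv : ‖v - P v‖ ≤ 1 := by
      refine le_trans ?_ hv
      rw [← Real.rpow_le_rpow_iff (norm_nonneg _) (norm_nonneg _) hp0, ← hP v]
      linarith [Real.rpow_nonneg (norm_nonneg (P v)) p]
    set x : E := (a : 𝕜) • P u + (b : 𝕜) • (v - P v) with hx
    have hPx : P x = (a : 𝕜) • P u := by simp [hx, hPP]
    have hQx : x - P x = (b : 𝕜) • (v - P v) := by rw [hPx, hx]; abel
    have hxn : ‖x‖ ≤ (a ^ p + b ^ p) ^ (1 / p) := by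
      rw [one_div, Real.le_rpow_inv_iff_of_pos (norm_nonneg _) (by positivity) hp0, ← hP x, hQx, hPx, norm_smul, norm_smul,
        RCLike.norm_of_nonneg ha, RCLike.norm_of_nonneg hb]
      gcongr
      · exact mul_le_of_le_one_right ha hPu
      · exact mul_le_of_le_one_right hb hQv
    have hφx : φ x = ((a * ‖φ.comp P u‖ + b * ‖φ.comp Q v‖ : ℝ) : 𝕜) := by
      have e1 : φ (P u) = (‖φ.comp P u‖ : 𝕜) := hu1
      have e2 : φ (v - P v) = (‖φ.comp Q v‖ : 𝕜) := hv1
      rw [hx, map_add, map_smul, map_smul, e1, e2]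
      push_cast
      simp only [smul_eq_mul]
    have h3 : a * ‖φ.comp P u‖ + b * ‖φ.comp Q v‖ ≤ ‖φ‖ * (a ^ p + b ^ p) ^ (1 / p) := by
      calc _ = ‖φ x‖ := by rw [hφx, RCLike.norm_of_nonneg (by positivity)]
        _ ≤ ‖φ‖ * ‖x‖ := φ.le_opNorm x
        _ ≤ _ := by gcongr
    have h4 : (a + b) * δ ≤ ε := by
      rw [hδ, mul_div_assoc', div_le_iff₀ (by positivity)]
      nlinarith
    have h5 : a * (α - δ) ≤ a * ‖φ.comp P u‖ := by gcongr
    have h6 : b * (β - δ) ≤ b * ‖φ.comp Q v‖ := by gcongr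
    linarith
  have hα0 : 0 ≤ α := norm_nonneg _
  have hβ0 : 0 ≤ β := norm_nonneg _
  have e1 : ∀ t : ℝ, 0 ≤ t → t ^ (q - 1) * t = t ^ q := fun t ht => by
    rw [← Real.rpow_add_one' ht (by linarith), sub_add_cancel]
  have e2 : ∀ t : ℝ, 0 ≤ t → (t ^ (q - 1)) ^ p = t ^ q := fun t ht => by
    rw [← Real.rpow_mul ht, hpq.symm.sub_one_mul_conj]
  -- These weights are the equality case of Hölder: both sides become powers of `α ^ q + β ^ q`.
  have := key (α ^ (q - 1)) (β ^ (q - 1)) (by positivity) (by positivity)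
  rw [e1 _ hα0, e1 _ hβ0, e2 _ hα0, e2 _ hβ0] at this
  set S := α ^ q + β ^ q with hS
  have hS0 : 0 ≤ S := by positivity
  rcases hS0.eq_or_lt with h0 | h0
  · rw [← h0]; positivity
  · have h7 : S ^ (1 / q) * S ^ (1 / p) = S := by
      rw [← Real.rpow_add h0, one_div, one_div, add_comm, hpq.inv_add_inv_eq_one, Real.rpow_one]
    have h8 : S ^ (1 / q) ≤ ‖φ‖ := by
      refine le_of_mul_le_mul_right ?_ (Real.rpow_pos_of_pos h0 (1 / p))
      rw [h7]; exact this
    rw [one_div] at h8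
    exact (Real.rpow_inv_le_iff_of_pos hS0 (norm_nonneg _) hq0).1 h8

end Operators

/-! ### Functionals on spaces with `ℓ_p`-decompositions -/

section Decomposition

variable {𝕜 : Type*} [RCLike 𝕜] {E : Type*} [NormedAddCommGroup E] [NormedSpace 𝕜 E]
  {p q : ℝ} {P : ℕ → E →L[𝕜] E}

theorem Real.mul_add_mul_le_rpow_mul_rpow {p q : ℝ} (hpq : p.HolderConjugate q)
    {a b c d : ℝ} (ha : 0 ≤ a) (hb : 0 ≤ b) (hc : 0 ≤ c) (hd : 0 ≤ d) :
    a * c + b * d ≤ (a ^ q + b ^ q) ^ (1 / q) * (c ^ p + d ^ p) ^ (1 / p) := by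
  simpa [abs_of_nonneg ha, abs_of_nonneg hb, abs_of_nonneg hc, abs_of_nonneg hd] using
    Real.inner_le_Lp_mul_Lq Finset.univ ![a, b] ![c, d] hpq.symm

/-- The tails of a functional on a space with `ℓ_p`-decompositions tend to zero in norm. -/
theorem exists_norm_comp_id_sub_lt (hpq : p.HolderConjugate q)
    (hP : ∀ N x, ‖P N x‖ ^ p + ‖x - P N x‖ ^ p = ‖x‖ ^ p) (hPP : ∀ N x, P N (P N x) = P N x)
    (hlim : ∀ x, Tendsto (fun N => P N x) atTop (𝓝 x)) (φ : StrongDual 𝕜 E)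
    {ε : ℝ} (hε : 0 < ε) :
    ∃ N, ‖φ.comp (ContinuousLinearMap.id 𝕜 E - P N)‖ < ε := by
  have hq0 := hpq.symm.pos
  have hle : ∀ N, ‖φ.comp (P N)‖ ≤ ‖φ‖ := fun N => by
    rw [← Real.rpow_le_rpow_iff (norm_nonneg _) (norm_nonneg _) hq0]
    have := norm_comp_rpow_add_norm_comp_rpow_le hpq (hP N) (hPP N) φ
    linarith [Real.rpow_nonneg (norm_nonneg (φ.comp (ContinuousLinearMap.id 𝕜 E - P N))) q]
  -- Once the heads exhaust the norm of `φ`, the `q`-power inequality leaves nothing for the tails.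
  have hconv : Tendsto (fun N => ‖φ.comp (P N)‖) atTop (𝓝 ‖φ‖) := by
    refine tendsto_order.2 ⟨fun r hr => ?_, fun r hr => Eventually.of_forall fun N =>
      (hle N).trans_lt hr⟩
    obtain ⟨x, hx, -, hrx⟩ := exists_norm_le_one_apply_eq_norm φ hr
    have h1 : Tendsto (fun N => ‖φ (P N x)‖) atTop (𝓝 ‖φ x‖) :=
      ((φ.continuous.tendsto x).comp (hlim x)).norm
    filter_upwards [h1.eventually (lt_mem_nhds hrx)] with N hN
    exact hN.trans_le ((φ.comp (P N)).unit_le_opNorm x hx)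
  have h2 : Tendsto (fun N => ‖φ‖ ^ q - ‖φ.comp (P N)‖ ^ q) atTop (𝓝 0) := by
    have := (hconv.rpow_const (p := q) (Or.inr hq0.le)).const_sub (‖φ‖ ^ q)
    rwa [sub_self] at this
  obtain ⟨N, hN⟩ := (h2.eventually (gt_mem_nhds (Real.rpow_pos_of_pos hε q))).exists
  refine ⟨N, ?_⟩
  rw [← Real.rpow_lt_rpow_iff (norm_nonneg _) hε.le hq0]
  linarith [norm_comp_rpow_add_norm_comp_rpow_le hpq (hP N) (hPP N) φ]

/-- Asymptotic `q`-additivity of the dual norm along pointwise null sequences. -/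
theorem eventually_norm_add_le (hpq : p.HolderConjugate q)
    (hP : ∀ N x, ‖P N x‖ ^ p + ‖x - P N x‖ ^ p = ‖x‖ ^ p) (hPP : ∀ N x, P N (P N x) = P N x)
    (hlim : ∀ x, Tendsto (fun N => P N x) atTop (𝓝 x)) (hPc : ∀ N, IsCompactOperator (P N))
    (φ : StrongDual 𝕜 E) {ψ : ℕ → StrongDual 𝕜 E} {M : ℝ} (hM : ∀ᶠ k in atTop, ‖ψ k‖ ≤ M)
    (hψ : ∀ x, Tendsto (fun k => ψ k x) atTop (𝓝 0)) {ε : ℝ} (hε : 0 < ε) :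
    ∀ᶠ k in atTop, ‖φ + ψ k‖ ≤ (‖φ‖ ^ q + ‖ψ k‖ ^ q) ^ (1 / q) + ε := by
  obtain ⟨N, hN⟩ := exists_norm_comp_id_sub_lt hpq hP hPP hlim φ (half_pos hε)
  have h1 := ((hPc N).tendsto_comp_zero hM hψ).norm
  rw [norm_zero] at h1
  filter_upwards [h1.eventually (gt_mem_nhds (half_pos hε))] with k hk
  refine ContinuousLinearMap.opNorm_le_bound _ (by positivity) fun x => ?_
  -- Up to small errors `φ` lives on the head and `ψ k` on the tail: the tail of `φ` is small by
  -- choice of `N`, and `ψ k` is small on the head because `P N` is compact.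
  have e : (φ + ψ k) x = (φ (P N x) + ψ k (x - P N x)) +
      (φ.comp (ContinuousLinearMap.id 𝕜 E - P N) x + (ψ k).comp (P N) x) := by
    simp; ring
  have b1 : ‖φ (P N x)‖ ≤ ‖φ‖ * ‖P N x‖ := φ.le_opNorm _
  have b2 : ‖ψ k (x - P N x)‖ ≤ ‖ψ k‖ * ‖x - P N x‖ := (ψ k).le_opNorm _
  have b3 : ‖φ.comp (ContinuousLinearMap.id 𝕜 E - P N) x‖ ≤ ε / 2 * ‖x‖ :=
    (ContinuousLinearMap.le_opNorm _ _).trans (by gcongr)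
  have b4 : ‖(ψ k).comp (P N) x‖ ≤ ε / 2 * ‖x‖ :=
    (ContinuousLinearMap.le_opNorm _ _).trans (by gcongr)
  have b5 := Real.mul_add_mul_le_rpow_mul_rpow hpq (norm_nonneg φ) (norm_nonneg (ψ k))
    (norm_nonneg (P N x)) (norm_nonneg (x - P N x))
  rw [hP N x, one_div p, Real.rpow_rpow_inv (norm_nonneg x) hpq.pos.ne'] at b5
  rw [e]
  have t1 := norm_add_le (φ (P N x) + ψ k (x - P N x))
    (φ.comp (ContinuousLinearMap.id 𝕜 E - P N) x + (ψ k).comp (P N) x)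
  have t2 := norm_add_le (φ (P N x)) (ψ k (x - P N x))
  have t3 := norm_add_le (φ.comp (ContinuousLinearMap.id 𝕜 E - P N) x) ((ψ k).comp (P N) x)
  linarith

end Decomposition

/-! ### Coordinate truncations of `ℓ_r` -/

section Truncation

variable {𝕜 : Type*} [RCLike 𝕜] {r : ENNReal} [Fact (1 ≤ r)]

/-- The projection of `ℓ_r` onto its first `N` coordinates. -/
noncomputable def lpTruncation (𝕜 : Type*) [RCLike 𝕜] (r : ENNReal) [Fact (1 ≤ r)] (N : ℕ) :
    lp (fun _ : ℕ => 𝕜) r →L[𝕜] lp (fun _ : ℕ => 𝕜) r :=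
  ∑ i ∈ Finset.range N,
    (lp.singleContinuousLinearMap 𝕜 (fun _ : ℕ => 𝕜) r i).comp (lp.evalCLM 𝕜 (fun _ : ℕ => 𝕜) r i)

theorem lpTruncation_apply (N : ℕ) (x : lp (fun _ : ℕ => 𝕜) r) :
    lpTruncation 𝕜 r N x = ∑ i ∈ Finset.range N, lp.single r i (x i) := by
  simp only [lpTruncation, sum_apply]
  rfl

theorem lpTruncation_lpTruncation (N : ℕ) (x : lp (fun _ : ℕ => 𝕜) r) :
    lpTruncation 𝕜 r N (lpTruncation 𝕜 r N x) = lpTruncation 𝕜 r N x := by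
  rw [lpTruncation_apply N (lpTruncation 𝕜 r N x), lpTruncation_apply N x]
  refine Finset.sum_congr rfl fun i hi => ?_
  congr 1
  rw [lp.coeFn_sum, Finset.sum_apply, Finset.sum_eq_single i]
  · simp
  · intro j _ hj
    exact lp.single_apply_ne r j _ hj.symm
  · exact fun h => absurd hi h

theorem norm_lpTruncation_rpow_add (hr : 0 < r.toReal) (N : ℕ) (x : lp (fun _ : ℕ => 𝕜) r) :
    ‖lpTruncation 𝕜 r N x‖ ^ r.toReal + ‖x - lpTruncation 𝕜 r N x‖ ^ r.toReal =
      ‖x‖ ^ r.toReal := by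
  rw [lpTruncation_apply, lp.norm_sum_single hr, lp.norm_compl_sum_single hr]
  ring

theorem tendsto_lpTruncation (hr : r ≠ ⊤) (x : lp (fun _ : ℕ => 𝕜) r) :
    Tendsto (fun N => lpTruncation 𝕜 r N x) atTop (𝓝 x) := by
  simp_rw [lpTruncation_apply]
  exact (lp.hasSum_single hr x).tendsto_sum_nat

theorem isCompactOperator_lpTruncation (N : ℕ) : IsCompactOperator (lpTruncation 𝕜 r N) := by
  change lpTruncation 𝕜 r N ∈ compactOperator (RingHom.id 𝕜) _ _
  refine Submodule.sum_mem _ fun i _ => ?_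
  exact ((isCompactOperator_of_locallyCompactSpace_dom
    (lp.evalCLM 𝕜 (fun _ : ℕ => 𝕜) r i)).clm_comp
      (lp.singleContinuousLinearMap 𝕜 (fun _ : ℕ => 𝕜) r i) :)

end Truncation

/-! ### The asymptotic contraction estimate -/

section MainEstimate

variable {𝕜 : Type*} [RCLike 𝕜] {E Y : Type*} [NormedAddCommGroup E] [NormedSpace 𝕜 E]
  [NormedAddCommGroup Y] [NormedSpace 𝕜 Y]

theorem exists_norm_le_one_lt_norm_comp (A : E →L[𝕜] Y) {r : ℝ} (hr : r < ‖A‖) :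
    ∃ f : StrongDual 𝕜 Y, ‖f‖ ≤ 1 ∧ r < ‖f.comp A‖ := by
  obtain ⟨x, hx, hrx⟩ := A.exists_lt_apply_of_lt_opNorm hr
  obtain ⟨f, hf, hfx⟩ := exists_dual_vector'' 𝕜 (A x)
  refine ⟨f, hf, hrx.trans_le ?_⟩
  have h : ‖f.comp A x‖ = ‖A x‖ := by
    rw [ContinuousLinearMap.comp_apply, hfx, norm_algebraMap', norm_norm]
  rw [← h]
  exact (f.comp A).unit_le_opNorm x hx.le

theorem norm_le_and_norm_id_sub_le (C : Y →L[𝕜] Y) {η : ℝ}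
    (h : ‖ContinuousLinearMap.id 𝕜 Y - (2 : 𝕜) • C‖ ≤ 1 + 2 * η) :
    ‖C‖ ≤ 1 + η ∧ ‖ContinuousLinearMap.id 𝕜 Y - C‖ ≤ 1 + η := by
  set I := ContinuousLinearMap.id 𝕜 Y
  have hI : ‖I‖ ≤ 1 := ContinuousLinearMap.norm_id_le
  have two : ∀ B : Y →L[𝕜] Y, ‖(2 : 𝕜) • B‖ = 2 * ‖B‖ := fun B => by
    rw [norm_smul, RCLike.norm_ofNat]
  constructor
  · have e : (2 : 𝕜) • C = I - (I - (2 : 𝕜) • C) := by abel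
    have := norm_sub_le I (I - (2 : 𝕜) • C)
    rw [← e, two] at this
    linarith
  · have e : (2 : 𝕜) • (I - C) = I + (I - (2 : 𝕜) • C) := by rw [smul_sub, two_smul]; abel
    have := norm_add_le I (I - (2 : 𝕜) • C)
    rw [← e, two] at this
    linarith

variable {K : ℕ → Y →L[𝕜] Y}

/-- If `‖Id - 2 K_n‖ → 1`, reflecting a weak* null perturbation does not increase the norm
asymptotically. -/
theorem eventually_norm_sub_le (hK : ∀ n, IsCompactOperator (K n))
    (hb : ∀ f : StrongDual 𝕜 Y, Tendsto (fun n => f.comp (K n)) atTop (𝓝 f))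
    (hc : Tendsto (fun n => ‖ContinuousLinearMap.id 𝕜 Y - (2 : 𝕜) • K n‖) atTop (𝓝 1))
    (f : StrongDual 𝕜 Y) {z : ℕ → StrongDual 𝕜 Y} {M : ℝ} (hM : ∀ k, ‖z k‖ ≤ M)
    (hz : ∀ y, Tendsto (fun k => z k y) atTop (𝓝 0)) (h1 : ∀ k, ‖f + z k‖ ≤ 1)
    {η : ℝ} (hη : 0 < η) : ∀ᶠ k in atTop, ‖f - z k‖ ≤ 1 + η := by
  have hb' : Tendsto (fun n => ‖f - f.comp (K n)‖) atTop (𝓝 0) := by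
    simpa using ((hb f).const_sub f).norm
  obtain ⟨j, hj1, hj2⟩ := ((hc.eventually (gt_mem_nhds (show 1 < 1 + η / 2 by linarith))).and
    (hb'.eventually (gt_mem_nhds (show 0 < η / 8 by linarith)))).exists
  have hzj := ((hK j).tendsto_comp_zero (Eventually.of_forall hM) hz).norm
  rw [norm_zero] at hzj
  filter_upwards [hzj.eventually (gt_mem_nhds (show 0 < η / 8 by linarith))] with k hk
  set R := ContinuousLinearMap.id 𝕜 Y - (2 : 𝕜) • K j with hR
  -- With `j` fixed, the first term is small by (b), the second by compactness of `K j`, and the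
  -- third is at most `‖R‖`, which is near `1`.
  have e : f - z k = (2 : 𝕜) • (f - f.comp (K j)) - (2 : 𝕜) • (z k).comp (K j)
      - (f + z k).comp R := by
    ext y
    simp [hR]
    ring
  have t1 := norm_sub_le ((2 : 𝕜) • (f - f.comp (K j)) - (2 : 𝕜) • (z k).comp (K j))
    ((f + z k).comp R)
  have t2 := norm_sub_le ((2 : 𝕜) • (f - f.comp (K j))) ((2 : 𝕜) • (z k).comp (K j))
  rw [← e] at t1
  rw [norm_smul, norm_smul, RCLike.norm_ofNat] at t2
  have t3 : ‖(f + z k).comp R‖ ≤ ‖R‖ :=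
    (ContinuousLinearMap.opNorm_comp_le _ _).trans
      (mul_le_of_le_one_left (norm_nonneg _) (h1 k))
  linarith

/-- The averaging condition forces `q`-additivity of the dual norm along weak* null sequences. -/
theorem eventually_rpow_add_rpow_le {q : ℝ} (hq : 0 < q)
    (hK : ∀ n, IsCompactOperator (K n))
    (hb : ∀ f : StrongDual 𝕜 Y, Tendsto (fun n => f.comp (K n)) atTop (𝓝 f))
    (hc : Tendsto (fun n => ‖ContinuousLinearMap.id 𝕜 Y - (2 : 𝕜) • K n‖) atTop (𝓝 1))
    (h_avg : ∀ (f : StrongDual 𝕜 Y) (g : ℕ → StrongDual 𝕜 Y),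
      Tendsto (fun n => StrongDual.toWeakDual (g n)) atTop (𝓝 0) →
      limsup (fun n => (‖f‖ ^ q + ‖g n‖ ^ q) ^ (1 / q)) atTop ≤
        limsup (fun n => ((‖f + g n‖ ^ q + ‖f - g n‖ ^ q) / 2) ^ (1 / q)) atTop)
    (f : StrongDual 𝕜 Y) {z : ℕ → StrongDual 𝕜 Y} {M : ℝ} (hM : ∀ k, ‖z k‖ ≤ M)
    (hz : ∀ y, Tendsto (fun k => z k y) atTop (𝓝 0)) (h1 : ∀ k, ‖f + z k‖ ≤ 1)
    {η : ℝ} (hη : 0 < η) : ∀ᶠ k in atTop, (‖f‖ ^ q + ‖z k‖ ^ q) ^ (1 / q) ≤ 1 + η := by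
  have hw : Tendsto (fun n => StrongDual.toWeakDual (z n)) atTop (𝓝 0) := by
    refine (WeakBilin.tendsto_iff_forall_eval_tendsto (topDualPairing 𝕜 Y)
      ContinuousLinearMap.coe_injective).2 fun y => ?_
    exact hz y
  have hR : limsup (fun n => ((‖f + z n‖ ^ q + ‖f - z n‖ ^ q) / 2) ^ (1 / q)) atTop ≤
      1 + η / 2 := by
    refine limsup_le_of_le (isCoboundedUnder_le_of_le atTop (x := 0) fun n => by positivity) ?_
    filter_upwards [eventually_norm_sub_le hK hb hc f hM hz h1 (half_pos hη)] with k hk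
    rw [one_div, Real.rpow_inv_le_iff_of_pos (by positivity) (by positivity) hq]
    have a1 : ‖f + z k‖ ^ q ≤ (1 + η / 2) ^ q := by
      gcongr; linarith [h1 k]
    have a2 : ‖f - z k‖ ^ q ≤ (1 + η / 2) ^ q := by gcongr
    linarith
  have hL := (h_avg f z hw).trans_lt (hR.trans_lt (show 1 + η / 2 < 1 + η by linarith))
  have hbdd : IsBoundedUnder (· ≤ ·) atTop
      (fun n => (‖f‖ ^ q + ‖z n‖ ^ q) ^ (1 / q)) := by
    refine isBoundedUnder_of ⟨(‖f‖ ^ q + M ^ q) ^ (1 / q), fun n => ?_⟩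
    have := hM n
    gcongr
  exact (eventually_lt_of_limsup_lt hL hbdd).mono fun _ h => h.le

/-- The key estimate: `K_n T + (Id - K_m) S` is asymptotically a contraction if `T` and `S` are. -/
theorem eventually_eventually_norm_comp_add_sub_le {p q : ℝ} (hpq : p.HolderConjugate q)
    {P : ℕ → E →L[𝕜] E}
    (hP : ∀ N x, ‖P N x‖ ^ p + ‖x - P N x‖ ^ p = ‖x‖ ^ p) (hPP : ∀ N x, P N (P N x) = P N x)
    (hlim : ∀ x, Tendsto (fun N => P N x) atTop (𝓝 x)) (hPc : ∀ N, IsCompactOperator (P N))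
    (hK : ∀ n, IsCompactOperator (K n))
    (ha : ∀ y : Y, Tendsto (fun n => K n y) atTop (𝓝 y))
    (hb : ∀ f : StrongDual 𝕜 Y, Tendsto (fun n => f.comp (K n)) atTop (𝓝 f))
    (hc : Tendsto (fun n => ‖ContinuousLinearMap.id 𝕜 Y - (2 : 𝕜) • K n‖) atTop (𝓝 1))
    (h_avg : ∀ (f : StrongDual 𝕜 Y) (g : ℕ → StrongDual 𝕜 Y),
      Tendsto (fun n => StrongDual.toWeakDual (g n)) atTop (𝓝 0) →
      limsup (fun n => (‖f‖ ^ q + ‖g n‖ ^ q) ^ (1 / q)) atTop ≤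
        limsup (fun n => ((‖f + g n‖ ^ q + ‖f - g n‖ ^ q) / 2) ^ (1 / q)) atTop)
    {T S : E →L[𝕜] Y} (hT : ‖T‖ ≤ 1) (hS : ‖S‖ ≤ 1) {ε : ℝ} (hε : 0 < ε) :
    ∀ᶠ n in atTop, ∀ᶠ m in atTop, ‖(K n).comp T + (S - (K m).comp S)‖ ≤ 1 + ε := by
  have := separableSpace_of_tendsto_isCompactOperator hK ha
  have hq0 := hpq.symm.pos
  obtain ⟨η, hη, hη1⟩ : ∃ η : ℝ, 0 < η ∧ (1 + η) * (1 + η) + 2 * η ≤ 1 + ε := by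
    -- The left side is `1 + 4 * η + η ^ 2`, at most `1 + 5 * η` when `η ≤ 1`.
    refine ⟨min ε 1 / 5, by positivity, ?_⟩
    have h0 : 0 < min ε 1 := by positivity
    nlinarith [min_le_left ε 1, min_le_right ε 1]
  have hKη : ∀ᶠ n in atTop,
      ‖K n‖ ≤ 1 + η ∧ ‖ContinuousLinearMap.id 𝕜 Y - K n‖ ≤ 1 + η := by
    filter_upwards [hc.eventually (gt_mem_nhds (show 1 < 1 + 2 * η by linarith))] with n hn
    exact norm_le_and_norm_id_sub_le (K n) hn.le
  filter_upwards [hKη] with n hn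
  by_contra hcon
  rw [not_eventually] at hcon
  obtain ⟨σ, hσ, hσ'⟩ := extraction_of_frequently_atTop hcon
  choose f hf hfn using fun k => exists_norm_le_one_lt_norm_comp _ (not_le.1 (hσ' k))
  obtain ⟨g, τ, hτ, hg⟩ := exists_seq_tendsto_weakDual f hf
  set z : ℕ → StrongDual 𝕜 Y := fun k => f (τ k) - g with hz
  set μ : ℕ → ℕ := fun k => σ (τ k) with hμ
  have hμt : Tendsto μ atTop atTop := hσ.tendsto_atTop.comp hτ.tendsto_atTop
  have hgz : ∀ k, g + z k = f (τ k) := fun k => by simp [hz]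
  have hz0 : ∀ y, Tendsto (fun k => z k y) atTop (𝓝 0) := fun y => by
    simpa [hz] using (hg y).sub_const (g y)
  have hzM : ∀ k, ‖z k‖ ≤ 1 + ‖g‖ := fun k =>
    (norm_sub_le _ _).trans (by linarith [hf (τ k)])
  have hadd := eventually_rpow_add_rpow_le hq0 hK hb hc h_avg g hzM hz0
    (fun k => by rw [hgz]; exact hf _) hη
  have hKμ := hμt.eventually hKη
  set D : ℕ → E →L[𝕜] Y := fun k => S - (K (μ k)).comp S with hD
  have hDx : ∀ x, Tendsto (fun k => D k x) atTop (𝓝 0) := fun x => by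
    have := ((ha (S x)).comp hμt).const_sub (S x)
    rw [sub_self] at this
    exact this
  have hDe : ∀ k, D k = (ContinuousLinearMap.id 𝕜 Y - K (μ k)).comp S := fun k => by
    ext x; simp [hD]
  have hDn : ∀ᶠ k in atTop, ‖D k‖ ≤ 1 + η := by
    filter_upwards [hKμ] with k hk
    rw [hDe]
    refine (ContinuousLinearMap.opNorm_comp_le _ _).trans ?_
    exact (mul_le_of_le_one_right (norm_nonneg _) hS).trans hk.2
  have hψn : ∀ᶠ k in atTop, ‖(z k).comp (D k)‖ ≤ (1 + η) * ‖z k‖ := by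
    filter_upwards [hDn] with k hk
    refine (ContinuousLinearMap.opNorm_comp_le _ _).trans ?_
    rw [mul_comm]
    gcongr
  have hψM : ∀ᶠ k in atTop, ‖(z k).comp (D k)‖ ≤ (1 + η) * (1 + ‖g‖) := by
    filter_upwards [hψn] with k hk
    have := hzM k
    exact hk.trans (by gcongr)
  have hψ0 : ∀ x, Tendsto (fun k => (z k).comp (D k) x) atTop (𝓝 0) := fun x => by
    have h := ((hDx x).norm).const_mul (1 + ‖g‖)
    rw [norm_zero, mul_zero] at h
    refine squeeze_zero_norm (fun k => ?_) h
    refine ((z k).le_opNorm (D k x)).trans ?_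
    have := hzM k
    gcongr
  set φ : StrongDual 𝕜 E := g.comp ((K n).comp T) with hφ
  have hφn : ‖φ‖ ≤ (1 + η) * ‖g‖ := by
    refine (ContinuousLinearMap.opNorm_comp_le _ _).trans ?_
    rw [mul_comm]
    gcongr
    refine (ContinuousLinearMap.opNorm_comp_le _ _).trans ?_
    exact (mul_le_of_le_one_right (norm_nonneg _) hT).trans hn.1
  have hB := eventually_norm_add_le hpq hP hPP hlim hPc φ hψM hψ0 hη
  have hr1 : Tendsto (fun k => ‖(z k).comp (K n)‖) atTop (𝓝 0) := by
    simpa using ((hK n).tendsto_comp_zero (Eventually.of_forall hzM) hz0).norm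
  have hr2 : Tendsto (fun k => ‖g - g.comp (K (μ k))‖) atTop (𝓝 0) := by
    simpa using (((hb g).comp hμt).const_sub g).norm
  obtain ⟨k, hk1, hk2, hk3, hk4, hk5⟩ := (hadd.and (hψn.and (hB.and
    ((hr1.eventually (gt_mem_nhds (half_pos hη))).and
      (hr2.eventually (gt_mem_nhds (half_pos hη))))))).exists
  -- The last two terms are norm-null: `z k` against the fixed compact `K n`, and `g` against `Id -
  -- K (μ k)` by (b).
  have e : (f (τ k)).comp ((K n).comp T + (S - (K (σ (τ k))).comp S)) =
      (φ + (z k).comp (D k)) + (((z k).comp (K n)).comp T + (g - g.comp (K (μ k))).comp S) := by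
    rw [← hgz]
    ext x
    simp [hφ, hD, hμ]
    ring
  have t0 := hfn (τ k)
  rw [e] at t0
  have t1 := norm_add_le (φ + (z k).comp (D k))
    (((z k).comp (K n)).comp T + (g - g.comp (K (μ k))).comp S)
  have t2 := norm_add_le (((z k).comp (K n)).comp T) ((g - g.comp (K (μ k))).comp S)
  have t3 : ‖((z k).comp (K n)).comp T‖ ≤ ‖(z k).comp (K n)‖ :=
    (ContinuousLinearMap.opNorm_comp_le _ _).trans (mul_le_of_le_one_right (norm_nonneg _) hT)
  have t4 : ‖(g - g.comp (K (μ k))).comp S‖ ≤ ‖g - g.comp (K (μ k))‖ :=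
    (ContinuousLinearMap.opNorm_comp_le _ _).trans (mul_le_of_le_one_right (norm_nonneg _) hS)
  have t5 : (‖φ‖ ^ q + ‖(z k).comp (D k)‖ ^ q) ^ (1 / q) ≤ (1 + η) * (1 + η) := by
    calc _ ≤ (((1 + η) * ‖g‖) ^ q + ((1 + η) * ‖z k‖) ^ q) ^ (1 / q) := by gcongr
      _ = (1 + η) * (‖g‖ ^ q + ‖z k‖ ^ q) ^ (1 / q) := by
        rw [Real.mul_rpow (by positivity) (norm_nonneg _),
          Real.mul_rpow (by positivity) (norm_nonneg _), ← mul_add,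
          Real.mul_rpow (by positivity) (by positivity), one_div,
          Real.rpow_rpow_inv (by positivity) hq0.ne']
      _ ≤ _ := by gcongr
  linarith

end MainEstimate

/-! ### From the estimate to the `M`-ideal property -/

section MIdeal

variable {𝕜 : Type*} [RCLike 𝕜] {E Y : Type*} [NormedAddCommGroup E] [NormedSpace 𝕜 E]
  [NormedAddCommGroup Y] [NormedSpace 𝕜 Y]

/-- Ultrafilter limits of `f (K_n T)` define a bounded operator on the dual of the space of
operators. -/
theorem exists_ultrafilter_limit_operator {K : ℕ → Y →L[𝕜] Y} {M : ℝ} (hM : ∀ n, ‖K n‖ ≤ M)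
    (U : Ultrafilter ℕ) :
    ∃ Φ : StrongDual 𝕜 (E →L[𝕜] Y) →L[𝕜] StrongDual 𝕜 (E →L[𝕜] Y),
      ∀ f T, Tendsto (fun n => f ((K n).comp T)) U (𝓝 (Φ f T)) := by
  have hbd : ∀ (f : StrongDual 𝕜 (E →L[𝕜] Y)) (T : E →L[𝕜] Y) n,
      ‖f ((K n).comp T)‖ ≤ M * ‖f‖ * ‖T‖ := fun f T n => by
    have h1 := (f.le_opNorm ((K n).comp T)).trans
      (mul_le_mul_of_nonneg_left ((K n).opNorm_comp_le T) (norm_nonneg f))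
    have h2 : ‖f‖ * (‖K n‖ * ‖T‖) ≤ ‖f‖ * (M * ‖T‖) := by
      have := hM n
      gcongr
    linarith
  have hex : ∀ (f : StrongDual 𝕜 (E →L[𝕜] Y)) (T : E →L[𝕜] Y),
      ∃ c, Tendsto (fun n => f ((K n).comp T)) U (𝓝 c) := fun f T => by
    obtain ⟨c, -, hc⟩ := (isCompact_closedBall (0 : 𝕜) (M * ‖f‖ * ‖T‖)).ultrafilter_le_nhds
      (U.map fun n => f ((K n).comp T)) (tendsto_principal.2
        (Eventually.of_forall fun n => by simpa using hbd f T n))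
    exact ⟨c, hc⟩
  choose L hL using hex
  refine ⟨LinearMap.mkContinuous₂ (LinearMap.mk₂ 𝕜 L ?_ ?_ ?_ ?_) M ?_, fun f T => hL f T⟩
  · intro f g T
    exact tendsto_nhds_unique (hL (f + g) T) ((hL f T).add (hL g T))
  · intro c f T
    exact tendsto_nhds_unique (hL (c • f) T) ((hL f T).const_smul c)
  · intro f T S
    refine tendsto_nhds_unique (hL f (T + S)) (((hL f T).add (hL f S)).congr fun n => ?_)
    rw [ContinuousLinearMap.comp_add, map_add]
  · intro c f T
    refine tendsto_nhds_unique (hL f (c • T)) (((hL f T).const_smul c).congr fun n => ?_)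
    rw [ContinuousLinearMap.comp_smul, map_smul]
  · intro f T
    exact le_of_tendsto (hL f T).norm (Eventually.of_forall (hbd f T))

/-- Since `K n S → S` in norm for compact `S`, the limit operator `Φ` preserves values on compact
operators; as each `K n T` is compact, `Φ` is idempotent and kills exactly the annihilator. -/
theorem isMIdeal_compactOperator_of_eventually_norm_le [CompleteSpace Y] {K : ℕ → Y →L[𝕜] Y}
    (hK : ∀ n, IsCompactOperator (K n))
    (ha : ∀ y : Y, Tendsto (fun n => K n y) atTop (𝓝 y))
    (hest : ∀ T S : E →L[𝕜] Y, ‖T‖ ≤ 1 → ‖S‖ ≤ 1 → ∀ ε : ℝ, 0 < ε →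
      ∀ᶠ n in atTop, ∀ᶠ m in atTop, ‖(K n).comp T + (S - (K m).comp S)‖ ≤ 1 + ε) :
    IsMIdeal (compactOperator (RingHom.id 𝕜) E Y) := by
  obtain ⟨M, hM⟩ := banach_steinhaus (g := K) fun y => by
    obtain ⟨C, hC⟩ := (ha y).norm.bddAbove_range
    exact ⟨C, fun n => hC ⟨n, rfl⟩⟩
  set U : Ultrafilter ℕ := hyperfilter ℕ
  have hU : (U : Filter ℕ) ≤ atTop := Nat.hyperfilter_le_atTop
  obtain ⟨Φ, hΦ⟩ := exists_ultrafilter_limit_operator (E := E) hM U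
  have hcomp : ∀ S : E →L[𝕜] Y, IsCompactOperator S →
      Tendsto (fun n => (K n).comp S) U (𝓝 S) := fun S hS => by
    have h := hS.tendsto_comp_zero (A := fun n => K n - ContinuousLinearMap.id 𝕜 Y)
      (M := M + 1) (l := atTop)
      (Eventually.of_forall fun n => (norm_sub_le _ _).trans
        (add_le_add (hM n) ContinuousLinearMap.norm_id_le))
      (fun y => by simpa using (ha y).sub_const y)
    have h' := (h.mono_left hU).add_const S
    rw [zero_add] at h'
    refine h'.congr fun n => ?_
    ext x
    simp
  have hKc : ∀ n (T : E →L[𝕜] Y), IsCompactOperator ((K n).comp T) :=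
    fun n T => (hK n).comp_clm T
  have hΦJ : ∀ f, ∀ S : E →L[𝕜] Y, IsCompactOperator S → Φ f S = f S := fun f S hS =>
    tendsto_nhds_unique (hΦ f S) ((f.continuous.tendsto S).comp (hcomp S hS))
  have hΦ0 : ∀ f ∈ normedAnnihilator (compactOperator (RingHom.id 𝕜) E Y), Φ f = 0 :=
    fun f hf => by
      ext T
      refine tendsto_nhds_unique (hΦ f T) (tendsto_const_nhds.congr fun n => ?_)
      exact (hf _ (hKc n T)).symm
  have hΦΦ : ∀ f, Φ (Φ f) = Φ f := fun f => by
    ext T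
    refine tendsto_nhds_unique (hΦ (Φ f) T) ((hΦ f T).congr fun n => ?_)
    exact (hΦJ f _ (hKc n T)).symm
  refine ⟨isClosed_setOfPred_isCompactOperator,
    LinearMap.ker (ContinuousLinearMap.id 𝕜 (StrongDual 𝕜 (E →L[𝕜] Y)) - Φ).toLinearMap,
    ContinuousLinearMap.isClosed_ker _, ?_, ?_⟩
  · have hmem : ∀ f, f ∈ LinearMap.ker
        (ContinuousLinearMap.id 𝕜 (StrongDual 𝕜 (E →L[𝕜] Y)) - Φ).toLinearMap ↔ Φ f = f :=
      fun f => by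
        rw [LinearMap.mem_ker]
        exact sub_eq_zero.trans eq_comm
    refine ⟨Submodule.disjoint_def.2 fun f hf hf' => ?_,
      Submodule.codisjoint_iff_exists_add_eq.2 fun f => ⟨f - Φ f, Φ f, fun S hS => ?_, ?_, ?_⟩⟩
    · rw [← (hmem f).1 hf', hΦ0 f hf]
    · rw [sub_apply, hΦJ f S hS, sub_self]
    · exact (hmem _).2 (hΦΦ f)
    · exact sub_add_cancel f (Φ f)
  · intro f hf g hg
    have hg' : Φ g = g := (sub_eq_zero.1 (LinearMap.mem_ker.1 hg)).symm
    refine le_antisymm (norm_add_le f g) (le_of_forall_pos_le_add fun ε hε => ?_)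
    set δ := ε / (‖f + g‖ + 4) with hδ
    have hδ0 : 0 < δ := by positivity
    have hδε : δ * (‖f + g‖ + 4) = ε := by rw [hδ]; field_simp
    obtain ⟨S, hS, hS1, hS2⟩ := exists_norm_le_one_apply_eq_norm f
      (show ‖f‖ - δ < ‖f‖ by linarith)
    obtain ⟨T, hT, hT1, hT2⟩ := exists_norm_le_one_apply_eq_norm g
      (show ‖g‖ - δ < ‖g‖ by linarith)
    have hlim : ∀ R : E →L[𝕜] Y, ∀ᶠ n in U, ‖g ((K n).comp R) - g R‖ < δ := fun R => by
      have h := hΦ g R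
      rw [hg'] at h
      have h' := (h.sub_const (g R)).norm
      rw [sub_self, norm_zero] at h'
      exact h'.eventually (gt_mem_nhds hδ0)
    -- Test `f + g` on `K n T + (S - K m S)`: `f` sees only `S`, as it vanishes on compact
    -- operators, while `g = Φ g` sees nearly only `T`. The index `n` is fixed before `m`, as in the
    -- estimate.
    obtain ⟨n, hn, hn'⟩ := (((hest T S hT hS δ hδ0).filter_mono hU).and (hlim T)).exists
    obtain ⟨m, hm, hm'⟩ := ((hn.filter_mono hU).and (hlim S)).exists
    have e : (f + g) ((K n).comp T + (S - (K m).comp S)) =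
        ((‖f S‖ + ‖g T‖ : ℝ) : 𝕜) + ((g ((K n).comp T) - g T) - (g ((K m).comp S) - g S)) := by
      have h1 : f ((K n).comp T) = 0 := hf _ (hKc n T)
      have h2 : f ((K m).comp S) = 0 := hf _ (hKc m S)
      rw [RCLike.ofReal_add]
      simp only [add_apply, map_add, map_sub, h1, h2]
      linear_combination hS1 + hT1
    have b1 : ‖(f + g) ((K n).comp T + (S - (K m).comp S))‖ ≤ ‖f + g‖ * (1 + δ) :=
      ((f + g).le_opNorm _).trans (by gcongr)
    have b2 : ((‖f S‖ + ‖g T‖ : ℝ) : 𝕜) = (f + g) ((K n).comp T + (S - (K m).comp S)) -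
        ((g ((K n).comp T) - g T) - (g ((K m).comp S) - g S)) := by rw [e]; ring
    have b3 : ‖f S‖ + ‖g T‖ = ‖((‖f S‖ + ‖g T‖ : ℝ) : 𝕜)‖ :=
      (RCLike.norm_of_nonneg (by positivity)).symm
    rw [b2] at b3
    have b4 := norm_sub_le ((f + g) ((K n).comp T + (S - (K m).comp S)))
      ((g ((K n).comp T) - g T) - (g ((K m).comp S) - g S))
    have b5 := norm_sub_le (g ((K n).comp T) - g T) (g ((K m).comp S) - g S)
    linarith

end MIdeal

/-! ### The theorem for `ℓ_p` -/

theorem theorem3p3 {𝕜 : Type*} [RCLike 𝕜]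
    {Y : Type*} [NormedAddCommGroup Y] [NormedSpace 𝕜 Y] [CompleteSpace Y]
    (p p' : ℝ) [Fact (1 ≤ ENNReal.ofReal p)] (hp : 1 < p) (hpp' : 1 / p + 1 / p' = 1)
    (K : ℕ → Y →L[𝕜] Y)
    (hK : ∀ n, IsCompactOperator (K n))
    (ha : ∀ y : Y, Tendsto (fun n => K n y) atTop (𝓝 y))
    (hb : ∀ f : StrongDual 𝕜 Y, Tendsto (fun n => f.comp (K n)) atTop (𝓝 f))
    (hc : Tendsto (fun n => ‖ContinuousLinearMap.id 𝕜 Y - (2 : 𝕜) • K n‖) atTop (𝓝 1))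
    (h_avg : ∀ (f : StrongDual 𝕜 Y) (g : ℕ → StrongDual 𝕜 Y),
      Tendsto (fun n => StrongDual.toWeakDual (g n)) atTop (𝓝 0) →
      limsup (fun n => (‖f‖ ^ p' + ‖g n‖ ^ p') ^ (1 / p')) atTop ≤
        limsup (fun n => ((‖f + g n‖ ^ p' + ‖f - g n‖ ^ p') / 2) ^ (1 / p')) atTop) :
    IsMIdeal
      (compactOperator (RingHom.id 𝕜) (lp (fun _ : ℕ => 𝕜) (ENNReal.ofReal p)) Y) := by
  have hpq : p.HolderConjugate p' :=
    Real.holderConjugate_iff.2 ⟨hp, by simpa only [one_div] using hpp'⟩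
  have hr : (ENNReal.ofReal p).toReal = p := ENNReal.toReal_ofReal hpq.nonneg
  refine isMIdeal_compactOperator_of_eventually_norm_le hK ha fun T S hT hS ε hε => ?_
  refine eventually_eventually_norm_comp_add_sub_le hpq
    (P := lpTruncation 𝕜 (ENNReal.ofReal p)) (fun N x => ?_) lpTruncation_lpTruncation
    (tendsto_lpTruncation ENNReal.ofReal_ne_top) isCompactOperator_lpTruncation
    hK ha hb hc h_avg hT hS hε
  have h := norm_lpTruncation_rpow_add (hr.symm ▸ hpq.pos) N x
  rwa [hr] at h
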